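/- Let $m,n\ge 1$ be integers with $m\neq n$, and let $\mathrm{S}(m,n)$ be the Baumslag--Solitar semigroup, i.e. the semigroup with (semigroup) presentation $\langle x,y \mid yx^m = x^n y\rangle$. Then $\mathrm{S}(m,n)$ is Malcev coherent; that is, $\mathrm{S}(m,n)$ embeds in a group, and every finitely generated subsemigroup of $\mathrm{S}(m,n)$ admits a finite Malcev presentation. Here a congruence $\sigma$ on a semigroup $T$ is a Malcev congruence if $T/\sigma$ embeds in a group. For an alphabet $A$ with free semigroup $A^+$ and a relation $\rho\subseteq A^+\times A^+$, let $\rho^{\mathrm M}$ denote the smallest Malcev congruence on $A^+$ containing $\rho$, i.e. the intersection of all Malcev congruences on $A^+$ that contain $\rho$. A semigroup $T$ admits a finite Malcev presentation if there are a finite alphabet $A$ and a finite relation $\rho\subseteq A^+\times A^+$ with $T\cong A^+/\rho^{\mathrm M}$. -/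

import Mathlib

universe u

/-- A semigroup is group-embeddable if it admits an injective homomorphism into some group. (The
image generates a subgroup of the same universe level, so nothing is lost by fixing the level.) -/
def IsGroupEmbeddable (S : Type u) [Semigroup S] : Prop :=
  ∃ (G : Type u) (_ : Group G) (f : S →ₙ* G), Function.Injective f

/-- A Malcev congruence on a semigroup: the quotient by it is group-embeddable. -/
def IsMalcevCongruence {S : Type u} [Semigroup S] (σ : Con S) : Prop :=
  IsGroupEmbeddable σ.Quotient

/-- The smallest Malcev congruence on the free semigroup `A⁺` containing `ρ`: the intersection of
all Malcev congruences on `A⁺` that contain `ρ`. -/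
def malcevCon {A : Type u} (ρ : Set (FreeSemigroup A × FreeSemigroup A)) :
    Con (FreeSemigroup A) :=
  sInf {σ | (∀ p ∈ ρ, σ p.1 p.2) ∧ IsMalcevCongruence σ}

/-- The intersection of all Malcev congruences containing `ρ` is itself a Malcev congruence, so
`malcevCon ρ` really is the smallest one. -/
theorem isMalcevCongruence_malcevCon {A : Type u}
    (ρ : Set (FreeSemigroup A × FreeSemigroup A)) : IsMalcevCongruence (malcevCon ρ) := by
  let I := {σ : Con (FreeSemigroup A) // (∀ p ∈ ρ, σ p.1 p.2) ∧ IsMalcevCongruence σ}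
  have hI : ∀ i : I, IsGroupEmbeddable i.1.Quotient := fun i => i.2.2
  choose G hG f hf using hI
  have key : ∀ a b : FreeSemigroup A,
      malcevCon ρ a b ↔ ∀ i : I, f i (a : i.1.Quotient) = f i (b : i.1.Quotient) := by
    intro a b
    constructor
    · intro h i
      exact congrArg _ (i.1.eq.2 (h i.1 i.2))
    · intro h c hc
      exact c.eq.1 (hf ⟨c, hc⟩ (h ⟨c, hc⟩))
  refine ⟨∀ i, G i, inferInstance,
    { toFun := fun q => Con.liftOn q (fun a i => f i (a : i.1.Quotient))
        (fun a b h => funext ((key a b).1 h))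
      map_mul' := ?_ }, ?_⟩
  · intro p q
    refine Con.induction_on₂ p q fun a b => ?_
    funext i
    exact (f i).map_mul (a : i.1.Quotient) (b : i.1.Quotient)
  · intro p q
    refine Con.induction_on₂ p q fun a b h => ?_
    exact (Con.eq _).2 ((key a b).2 fun i => congrFun h i)

/-- The semigroup `S` has a finite Malcev presentation: it is isomorphic to the quotient of `A⁺` by
the smallest Malcev congruence containing `ρ`, for a finite alphabet `A` and a finite relation `ρ`
on `A⁺`. -/
def HasFiniteMalcevPresentation (S : Type u) [Semigroup S] : Prop :=
  ∃ (A : Type) (_ : Finite A) (ρ : Set (FreeSemigroup A × FreeSemigroup A)),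
    ρ.Finite ∧ Nonempty ((malcevCon ρ).Quotient ≃* S)

/-- A group-embeddable semigroup is Malcev coherent if all of its finitely generated subsemigroups
admit finite Malcev presentations. -/
def IsMalcevCoherent (S : Type u) [Semigroup S] : Prop :=
  IsGroupEmbeddable S ∧
    ∀ X : Set S, X.Finite → HasFiniteMalcevPresentation (Subsemigroup.closure X)

/-- The two generators of the Baumslag-Solitar semigroups. -/
inductive BSGen : Type
  | x
  | y

/-- The single defining relation `(y x ^ m, x ^ n y)`. A free semigroup has no identity, so the word
`y x ^ m` is built from `y` by multiplying `m` times on the right by `x`, and `x ^ n y` is built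
from `y` by multiplying `n` times on the left by `x`. -/
inductive BSRel (m n : ℕ) : FreeSemigroup BSGen → FreeSemigroup BSGen → Prop
  | rel : BSRel m n
      ((fun w => w * FreeSemigroup.of BSGen.x)^[m] (FreeSemigroup.of BSGen.y))
      ((fun w => FreeSemigroup.of BSGen.x * w)^[n] (FreeSemigroup.of BSGen.y))

/-- The Baumslag-Solitar semigroup `S(m, n)`, presented as a semigroup by two generators `x`, `y`
and the single relation `(y x ^ m, x ^ n y)`. -/
abbrev BaumslagSolitarSemigroup (m n : ℕ) : Type := (conGen (BSRel m n)).Quotient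

/-! The semigroup embeds in a group `G` in which every positive element has a unique normal form `x
^ a * y x ^ i₁ * ⋯ * y x ^ iₕ` with digits `iⱼ < m`. The group carries two measurements: the height,
which counts letters `y`, and the translation part `tr` of an affine action on ℚ where `x` adds 1
and `y` multiplies by `λ = n/m`.

Let `m < n`, so `λ > 1`. In a product of boundedly many kinds of factors of positive height, `tr` is
dominated by its last terms, as in a geometric series: `tr p ≤ C * λ ^ ht p` (`tr_prod_le`). By
uniqueness of normal forms, two left divisors of equal height of one positive element differ by a
power `x ^ d`. Since this contributes `λ ^ ht p * d` to `tr`, `d` is bounded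
(`inv_mul_mem_differences`). Hence two factorisations of one element can be read in parallel with
only finitely many differences of prefixes (`fellowTravel_prod`), and finitely many positive
relations govern all passages between differences (`exists_finite_relators_of_fellowTravel`).

Generators of height 0 are powers of `x` and may occur in arbitrarily long runs. They are tamed
first: up to finitely many remainders, such runs are powers of one word `κ`, and powers of `κ` can
be pushed to the right end (`exists_tails`, `exists_finite_rewriting`), where their common part
cancels.

For `m > n` the opposite semigroup satisfies the relation with `m` and `n` exchanged, and reversing
words transfers the result. Equality of the parameters is excluded because `λ = 1` gives no
geometric growth. -/

/-! ### Finitely many relations from finitely many differences of prefixes -/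

/-- The assignment `k` of the letters makes all the pairs of words in `ρ` equal. -/
def SatisfiesRel {A K : Type} [Monoid K] (k : A → K) (ρ : Set (FreeMonoid A × FreeMonoid A)) :
    Prop :=
  ∀ p ∈ ρ, FreeMonoid.lift k p.1 = FreeMonoid.lift k p.2

/-- Finitely many of the relations that hold between positive words in the elements `g a` imply,
in the sense of group presentations, all of them. -/
def HasFiniteRelators {A G : Type} [Group G] (g : A → G) : Prop :=
  ∃ ρ : Set (FreeMonoid A × FreeMonoid A), ρ.Finite ∧ SatisfiesRel g ρ ∧
    ∀ (K : Type) [Group K] (k : A → K), SatisfiesRel k ρ →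
      ∀ u v, FreeMonoid.lift g u = FreeMonoid.lift g v → FreeMonoid.lift k u = FreeMonoid.lift k v

/-- Pairs of words that can be read in steps from `B` so that all the differences of prefixes lie in
`F` and all the pairs of prefixes can be completed to a relation. -/
inductive FellowTravel {A G : Type} [Group G] (g : A → G) (F : Set G) (B : Set (FreeMonoid A)) :
    FreeMonoid A → FreeMonoid A → Prop
  | one : FellowTravel g F B 1 1
  | step {p q b c : FreeMonoid A} : FellowTravel g F B p q → b ∈ B → c ∈ B →
      (FreeMonoid.lift g (p * b))⁻¹ * FreeMonoid.lift g (q * c) ∈ F →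
      (∃ r s, FreeMonoid.lift g (p * b * r) = FreeMonoid.lift g (q * c * s)) →
      FellowTravel g F B (p * b) (q * c)

/-- For each difference `d` fix positive words with `d = P⁻¹ Q` and `P R = Q S`. The relations `P d
* b * R d' = Q d * c * S d'`, one for each passage `d' = b⁻¹ d c`, are positive. They force the
value of `p⁻¹ q` in any group satisfying them to depend only on its value `d` in `G`. -/
theorem exists_finite_relators_of_fellowTravel {A G : Type} [Group G] (g : A → G) {F : Set G}
    {B : Set (FreeMonoid A)} (hF : F.Finite) (hB : B.Finite) :
    ∃ ρ : Set (FreeMonoid A × FreeMonoid A), ρ.Finite ∧ SatisfiesRel g ρ ∧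
      ∀ (K : Type) [Group K] (k : A → K), SatisfiesRel k ρ → ∀ p q, FellowTravel g F B p q →
        FreeMonoid.lift g p = FreeMonoid.lift g q → FreeMonoid.lift k p = FreeMonoid.lift k q := by
  classical
  let D : Set G := {d | d ∈ insert 1 F ∧ ∃ p q r s : FreeMonoid A,
    (FreeMonoid.lift g p)⁻¹ * FreeMonoid.lift g q = d ∧
      FreeMonoid.lift g (p * r) = FreeMonoid.lift g (q * s)}
  have hD : D.Finite := (hF.insert 1).subset fun d h => h.1
  have h1 : (1 : G) ∈ D := ⟨Set.mem_insert _ _, 1, 1, 1, 1, by simp, rfl⟩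
  have hch : ∀ d : G, ∃ p q r s : FreeMonoid A, d ∈ D →
      (FreeMonoid.lift g p)⁻¹ * FreeMonoid.lift g q = d ∧
      FreeMonoid.lift g (p * r) = FreeMonoid.lift g (q * s) := by
    intro d
    by_cases h : d ∈ D
    · obtain ⟨-, p, q, r, s, h⟩ := h
      exact ⟨p, q, r, s, fun _ => h⟩
    · exact ⟨1, 1, 1, 1, fun h' => (h h').elim⟩
  choose P Q R S hPQ using hch
  let Φ : G × G × FreeMonoid A × FreeMonoid A → FreeMonoid A × FreeMonoid A := fun t =>
    (P t.1 * t.2.2.1 * R t.2.1, Q t.1 * t.2.2.2 * S t.2.1)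
  -- The pair `(P 1, Q 1)` makes the value attached to the difference 1 trivial, both at the start
  -- and at the end of a path.
  let ρ : Set (FreeMonoid A × FreeMonoid A) := insert (P 1, Q 1)
    ((Φ '' (D ×ˢ D ×ˢ (insert 1 B) ×ˢ (insert 1 B))) ∩
      {w | FreeMonoid.lift g w.1 = FreeMonoid.lift g w.2})
  refine ⟨ρ, ?_, ?_, ?_⟩
  · refine Set.Finite.insert _ (Set.Finite.inter_of_left (Set.Finite.image _ ?_) _)
    exact hD.prod (hD.prod ((hB.insert 1).prod (hB.insert 1)))
  · intro w hw
    rcases hw with rfl | hw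
    · exact inv_mul_eq_one.1 (hPQ 1 h1).1
    · exact hw.2
  · intro K _ k hk
    have key : ∀ d ∈ D, ∀ d' ∈ D, ∀ b ∈ insert 1 B, ∀ c ∈ insert 1 B,
        d' = (FreeMonoid.lift g b)⁻¹ * d * FreeMonoid.lift g c →
        FreeMonoid.lift k (P d * b * R d') = FreeMonoid.lift k (Q d * c * S d') := by
      intro d hd d' hd' b hb c hc h
      refine hk _ (Set.mem_insert_of_mem _ ⟨⟨(d, d', b, c), ⟨hd, hd', hb, hc⟩, rfl⟩, ?_⟩)
      have e1 := (hPQ d hd).1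
      have e2 := hPQ d' hd'
      have e3 : FreeMonoid.lift g (R d') = d' * FreeMonoid.lift g (S d') := by
        have e5 := e2.2
        rw [map_mul, map_mul, ← eq_inv_mul_iff_mul_eq, ← mul_assoc, e2.1] at e5
        exact e5
      have e4 : FreeMonoid.lift g (Q d) = FreeMonoid.lift g (P d) * d := by
        exact inv_mul_eq_iff_eq_mul.1 e1
      simp only [Set.mem_ofPred_eq, Φ, map_mul]
      rw [e3, e4, h]
      group
    -- Taking `b = c = 1` and `d' = d` gives `P R = Q S` in `K`, so `R S⁻¹` and `P⁻¹ Q` are two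
    -- expressions for the same value; this is why 1 was adjoined to `B`.
    have hτ : ∀ d ∈ D, FreeMonoid.lift k (R d) * (FreeMonoid.lift k (S d))⁻¹ =
        (FreeMonoid.lift k (P d))⁻¹ * FreeMonoid.lift k (Q d) := by
      intro d hd
      have := key d hd d hd 1 (Set.mem_insert _ _) 1 (Set.mem_insert _ _) (by simp)
      simp only [mul_one, map_mul] at this
      rw [eq_inv_mul_iff_mul_eq, ← mul_assoc, this, mul_inv_cancel_right]
    have h0 : FreeMonoid.lift k (P 1) = FreeMonoid.lift k (Q 1) := hk _ (Set.mem_insert _ _)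
    have main : ∀ p q, FellowTravel g F B p q →
        (FreeMonoid.lift g p)⁻¹ * FreeMonoid.lift g q ∈ D ∧
        (FreeMonoid.lift k p)⁻¹ * FreeMonoid.lift k q =
          (FreeMonoid.lift k (P ((FreeMonoid.lift g p)⁻¹ * FreeMonoid.lift g q)))⁻¹ *
            FreeMonoid.lift k (Q ((FreeMonoid.lift g p)⁻¹ * FreeMonoid.lift g q)) := by
      intro p q h
      induction h with
      | one => simp [h0, h1]
      | @step p q b c _ hb hc hd hrs ih =>
        obtain ⟨ihD, ih⟩ := ih
        obtain ⟨r, s, hrs⟩ := hrs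
        have hd' : (FreeMonoid.lift g (p * b))⁻¹ * FreeMonoid.lift g (q * c) ∈ D :=
          ⟨Set.mem_insert_of_mem _ hd, _, _, r, s, rfl, hrs⟩
        refine ⟨hd', ?_⟩
        have := key _ ihD _ hd' b (Set.mem_insert_of_mem _ hb) c (Set.mem_insert_of_mem _ hc)
          (by simp only [map_mul]; group)
        rw [← hτ _ hd']
        generalize (FreeMonoid.lift g (p * b))⁻¹ * FreeMonoid.lift g (q * c) = d' at this
        generalize (FreeMonoid.lift g p)⁻¹ * FreeMonoid.lift g q = d at this ih
        simp only [map_mul] at this ⊢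
        rw [eq_mul_inv_iff_mul_eq, mul_inv_rev]
        calc _ = (FreeMonoid.lift k b)⁻¹ * ((FreeMonoid.lift k p)⁻¹ * FreeMonoid.lift k q) *
              FreeMonoid.lift k c * FreeMonoid.lift k (S d') := by group
          _ = (FreeMonoid.lift k b)⁻¹ * (FreeMonoid.lift k (P d))⁻¹ * (FreeMonoid.lift k (Q d) *
              FreeMonoid.lift k c * FreeMonoid.lift k (S d')) := by rw [ih]; group
          _ = FreeMonoid.lift k (R d') := by rw [← this]; group
    intro p q h hg
    have := (main p q h).2
    rw [hg, inv_mul_cancel, h0, inv_mul_cancel] at this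
    exact inv_mul_eq_one.1 this

theorem HasFiniteRelators.op {A G : Type} [Group G] {g : A → G} (h : HasFiniteRelators g) :
    HasFiniteRelators fun a => MulOpposite.op (g a) := by
  have hrev : ∀ {K : Type} [Monoid K] (k : A → K) (w : FreeMonoid A),
      FreeMonoid.lift (fun a => MulOpposite.op (k a)) w.reverse =
        MulOpposite.op (FreeMonoid.lift k w) := by
    intro K _ k w
    induction w using FreeMonoid.inductionOn' with
    | one => rfl
    | of_mul a w ih => simp [ih, FreeMonoid.reverse_mul]
  obtain ⟨ρ, hρ, hg, hk⟩ := h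
  refine ⟨(fun p => (p.1.reverse, p.2.reverse)) '' ρ, hρ.image _, ?_, ?_⟩
  · rintro _ ⟨p, hp, rfl⟩
    simp only [hrev, hg p hp]
  · intro K _ k hsat u v huv
    have := hk Kᵐᵒᵖ (fun a => MulOpposite.op (k a)) (fun p hp => by
      have := hsat _ ⟨p, hp, rfl⟩
      have h2 := hrev k p.1.reverse
      have h3 := hrev k p.2.reverse
      simp only [FreeMonoid.reverse_reverse] at h2 h3 this
      rw [h2, h3, this]) u.reverse v.reverse (by
        have h2 := hrev (fun a => MulOpposite.op (g a)) u
        have h3 := hrev (fun a => MulOpposite.op (g a)) v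
        have h4 := hrev g u.reverse
        have h5 := hrev g v.reverse
        simp only [FreeMonoid.reverse_reverse] at h4 h5
        rw [h4, h5] at huv
        exact MulOpposite.op_injective huv)
    rw [hrev, hrev] at this
    exact MulOpposite.op_injective this

/-! ### From relators between monoid words to Malcev presentations -/

/-- Existence of finitely many implying relations, transferred to presentations. -/
theorem hasFiniteMalcevPresentation_closure {S G : Type} [Semigroup S] [Group G] (ι : S →ₙ* G)
    (hι : Function.Injective ι) (X : Set S) (hX : X.Finite)
    (h : HasFiniteRelators fun a : X => ι a) :
    HasFiniteMalcevPresentation (Subsemigroup.closure X) := by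
  obtain ⟨ρ, hρ, hg, hk⟩ := h
  let i : FreeSemigroup X →ₙ* FreeMonoid X := FreeSemigroup.lift FreeMonoid.of
  have hi : ∀ {K : Type} [Monoid K] (k : X → K) (u : FreeSemigroup X),
      FreeMonoid.lift k (i u) = FreeSemigroup.lift k u := by
    intro K _ k u
    induction u using FreeSemigroup.recOnMul with
    | ih1 a => simp [i]
    | ih2 a u _ ih => simp only [map_mul, ih]; simp [i]
  have hsurj : ∀ (a : X) (w : FreeMonoid X), ∃ u : FreeSemigroup X,
      i u = FreeMonoid.of a * w := by
    intro a w
    induction w using FreeMonoid.inductionOn' generalizing a with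
    | one => exact ⟨FreeSemigroup.of a, by simp [i]⟩
    | of_mul b w ih =>
      obtain ⟨u, hu⟩ := ih b
      exact ⟨FreeSemigroup.of a * u, by rw [map_mul, hu]; simp [i]⟩
  choose j hj using hsurj
  let π : FreeSemigroup X →ₙ* S := FreeSemigroup.lift (fun a : X => (a : S))
  have hπι : ∀ u, ι (π u) = FreeMonoid.lift (fun a : X => ι a) (i u) := by
    intro u
    rw [hi]
    induction u using FreeSemigroup.recOnMul with
    | ih1 a => simp [π]
    | ih2 a u _ ih => simp only [map_mul, ih]; simp [π]
  have hmem : ∀ u, π u ∈ Subsemigroup.closure X := by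
    intro u
    induction u using FreeSemigroup.recOnMul with
    | ih1 a => simpa [π] using Subsemigroup.subset_closure a.2
    | ih2 a u _ ih =>
      rw [map_mul]
      exact mul_mem (by simpa [π] using Subsemigroup.subset_closure a.2) ih
  -- A relation in `ρ` may involve the empty word, so both sides are prefixed by a letter; in a
  -- group this changes nothing, by cancellation.
  let ρ' : Set (FreeSemigroup X × FreeSemigroup X) :=
    (fun t : X × FreeMonoid X × FreeMonoid X => (j t.1 t.2.1, j t.1 t.2.2)) '' (Set.univ ×ˢ ρ)
  have := hX.to_subtype
  have key : ∀ u v, malcevCon ρ' u v ↔ π u = π v := by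
    intro u v
    constructor
    · intro huv
      let σ : Con (FreeSemigroup X) := Con.ker π
      -- The kernel of evaluation is itself a Malcev congruence, since its quotient embeds in `G`
      -- through `ι`.
      refine huv σ ⟨?_, G, inferInstance,
        { toFun := fun q => Con.liftOn q (fun a => ι (π a)) (fun a b h => congrArg ι h)
          map_mul' := ?_ }, ?_⟩
      · rintro _ ⟨⟨a, p⟩, ⟨-, hp⟩, rfl⟩
        refine hι ?_
        simp only [hπι, hj, map_mul]
        rw [hg p hp]
      · intro p q
        refine Con.induction_on₂ p q fun a b => ?_
        change ι (π (a * b)) = ι (π a) * ι (π b)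
        rw [map_mul, map_mul]
      · intro p q
        refine Con.induction_on₂ p q fun a b h => ?_
        exact (Con.eq _).2 (hι h)
    · intro huv σ hσ
      obtain ⟨hσρ, K, _, f, hf⟩ := hσ
      let k : X → K := fun a => f (FreeSemigroup.of a : σ.Quotient)
      have hkf : ∀ w : FreeSemigroup X, f (Con.toQuotient (c := σ) w) = FreeMonoid.lift k (i w) := by
        intro w
        rw [hi]
        induction w using FreeSemigroup.recOnMul with
        | ih1 a => simp [k]
        | ih2 a u _ ih => rw [Con.coe_mul, map_mul, ih, map_mul]; simp [k]
      refine (Con.eq σ).1 (hf ?_)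
      rw [hkf, hkf]
      refine hk K k ?_ _ _ (by rw [← hπι, ← hπι, huv])
      intro p hp
      -- The alphabet may be empty in general, but the nonempty word `u` supplies a letter.
      obtain ⟨a, -⟩ : ∃ a : X, True := by
        rcases u with ⟨a, -⟩
        exact ⟨a, trivial⟩
      have h1 := (Con.eq σ).2 (hσρ _ ⟨(a, p), ⟨trivial, hp⟩, rfl⟩)
      have h2 := congrArg f h1
      rw [hkf, hkf] at h2
      simpa [hj] using h2
  refine ⟨X, inferInstance, ρ', (Set.finite_univ.prod hρ).image _, ⟨MulEquiv.ofBijective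
    ({ toFun := fun q => Con.liftOn q (fun a => (⟨π a, hmem a⟩ : Subsemigroup.closure X))
        (fun a b h => Subtype.ext ((key a b).1 h))
       map_mul' := ?_ } : (malcevCon ρ').Quotient →ₙ* Subsemigroup.closure X) ⟨?_, ?_⟩⟩⟩
  · intro p q
    refine Con.induction_on₂ p q fun a b => ?_
    exact Subtype.ext (π.map_mul a b)
  · intro p q
    refine Con.induction_on₂ p q fun a b h => ?_
    exact (Con.eq _).2 ((key a b).2 (congrArg Subtype.val h))
  · rintro ⟨s, hs⟩
    have : ∃ u, π u = s := by
      induction hs using Subsemigroup.closure_induction with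
      | mem a ha => exact ⟨FreeSemigroup.of ⟨a, ha⟩, by simp [π]⟩
      | mul a b _ _ iha ihb =>
        obtain ⟨u, rfl⟩ := iha
        obtain ⟨v, rfl⟩ := ihb
        exact ⟨u * v, map_mul _ _ _⟩
    obtain ⟨u, rfl⟩ := this
    exact ⟨(u : (malcevCon ρ').Quotient), rfl⟩

/-! ### Normal forms and carrying -/

/-- The product of the elements `y * x ^ i`, for `i` running through the list `l`. -/
def digitWord {N : Type} [Monoid N] {m : ℕ} (x y : N) (l : List (Fin m)) : N :=
  (l.map fun i => y * x ^ (i : ℕ)).prod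

section digitWord

variable {N : Type} [Monoid N] {m n : ℕ} (x y : N)

@[simp]
theorem digitWord_nil : digitWord x y ([] : List (Fin m)) = 1 := rfl

@[simp]
theorem digitWord_cons (i : Fin m) (l : List (Fin m)) :
    digitWord x y (i :: l) = y * x ^ (i : ℕ) * digitWord x y l := rfl

theorem digitWord_append (l l' : List (Fin m)) :
    digitWord x y (l ++ l') = digitWord x y l * digitWord x y l' := by
  simp [digitWord]

theorem map_digitWord {N' F : Type} [Monoid N'] [FunLike F N N'] [MonoidHomClass F N N'] (f : F)
    (l : List (Fin m)) : f (digitWord x y l) = digitWord (f x) (f y) l := by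
  induction l with
  | nil => simp
  | cons i l ih => simp [ih]

variable {x y}

theorem mul_pow_mul_of_rel (h : y * x ^ m = x ^ n * y) (q : ℕ) :
    y * x ^ (m * q) = x ^ (n * q) * y := by
  induction q with
  | zero => simp
  | succ q ih => rw [mul_add_one, pow_add, ← mul_assoc, ih, mul_assoc, h, ← mul_assoc,
      ← pow_add, mul_add_one]

/-- This is addition with carry: a power of `x` entering from the right is added to the last digit,
and each full `m` leaves that digit to the left as `x ^ n`. -/
theorem digitWord_mul_pow (hm : 0 < m) (h : y * x ^ m = x ^ n * y) (l : List (Fin m)) (e : ℕ) :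
    ∃ (f : ℕ) (l' : List (Fin m)), l'.length = l.length ∧
      digitWord x y l * x ^ e = x ^ f * digitWord x y l' := by
  induction l with
  | nil => exact ⟨e, [], rfl, by simp⟩
  | cons i l ih =>
    obtain ⟨f, l', hl, hf⟩ := ih
    refine ⟨n * ((i + f) / m), ⟨(i + f) % m, Nat.mod_lt _ hm⟩ :: l', by simp [hl], ?_⟩
    have e' : x ^ (i + f : ℕ) = x ^ (m * ((i + f) / m)) * x ^ ((i + f) % m) := by
      rw [← pow_add, Nat.div_add_mod]
    calc digitWord x y (i :: l) * x ^ e = y * x ^ (i + f : ℕ) * digitWord x y l' := by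
          rw [digitWord_cons, mul_assoc, hf, pow_add]
          simp only [mul_assoc]
      _ = _ := by
          rw [e', ← mul_assoc y, mul_pow_mul_of_rel h, digitWord_cons]
          simp only [mul_assoc]

theorem digitWord_mul_pow_mul_pow (h : y * x ^ m = x ^ n * y) (l : List (Fin m)) (k : ℕ) :
    digitWord x y l * x ^ (k * m ^ l.length) = x ^ (k * n ^ l.length) * digitWord x y l := by
  induction l generalizing k with
  | nil => simp
  | cons i l ih =>
    rw [List.length_cons, digitWord_cons, mul_assoc, pow_succ' m, ← mul_assoc k, ih, ← mul_assoc,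
      mul_assoc y, ← pow_add, Nat.add_comm, pow_add, ← mul_assoc y, mul_comm k m,
      mul_assoc m, mul_pow_mul_of_rel h, pow_succ' n, mul_left_comm k n]
    simp only [mul_assoc]

theorem exists_eq_pow_mul_digitWord (hm : 0 < m) (h : y * x ^ m = x ^ n * y) {z : N}
    (hz : z ∈ Submonoid.closure {x, y}) :
    ∃ (a : ℕ) (l : List (Fin m)), z = x ^ a * digitWord x y l := by
  induction hz using Submonoid.closure_induction with
  | mem z hz =>
    rcases hz with rfl | rfl
    · exact ⟨1, [], by simp⟩
    · exact ⟨0, [⟨0, hm⟩], by simp⟩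
  | one => exact ⟨0, [], by simp⟩
  | mul z w _ _ hz hw =>
    obtain ⟨a, l, rfl⟩ := hz
    obtain ⟨b, l', rfl⟩ := hw
    obtain ⟨f, l'', -, hf⟩ := digitWord_mul_pow hm h l b
    refine ⟨a + f, l'' ++ l', ?_⟩
    rw [digitWord_append, pow_add, mul_assoc, ← mul_assoc (digitWord x y l), hf]
    simp only [mul_assoc]

theorem pow_mem_closure_pair (x y : N) (a : ℕ) : x ^ a ∈ Submonoid.closure {x, y} :=
  pow_mem (Submonoid.subset_closure (by simp)) a

theorem digitWord_mem_closure_pair (x y : N) (l : List (Fin m)) :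
    digitWord x y l ∈ Submonoid.closure {x, y} := by
  induction l with
  | nil => exact one_mem _
  | cons i l ih =>
    exact mul_mem (mul_mem (Submonoid.subset_closure (by simp)) (pow_mem_closure_pair x y _)) ih

end digitWord

/-! ### Height, translation and left divisors in a model -/

/-- A group with two elements that satisfy the Baumslag--Solitar relation and have unique
normal forms, with a height that counts the letters `y` and a translation length with respect to
an affine action on the rationals. -/
structure BSModel (m n : ℕ) (G : Type) [Group G] where
  /-- The first generator. -/
  x : G
  /-- The second generator. -/
  y : G
  rel : y * x ^ m = x ^ n * y
  /-- The height. -/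
  ht : G → ℤ
  ht_mul : ∀ a b, ht (a * b) = ht a + ht b
  ht_x : ht x = 0
  ht_y : ht y = 1
  /-- The image of `0` under the affine action. -/
  tr : G → ℚ
  tr_mul : ∀ a b, tr (a * b) = tr a + ((n : ℚ) / m) ^ ht a * tr b
  tr_x : tr x = 1
  tr_y : tr y = 0
  normalForm_inj : ∀ (a b : ℕ) (l l' : List (Fin m)),
    x ^ a * digitWord x y l = x ^ b * digitWord x y l' → a = b ∧ l = l'

namespace BSModel

variable {m n : ℕ} {G : Type} [Group G] (𝓑 : BSModel m n G)

/-- The submonoid generated by `x` and `y`. -/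
def pos : Submonoid G := Submonoid.closure {𝓑.x, 𝓑.y}

theorem ht_one : 𝓑.ht 1 = 0 := by
  simpa using 𝓑.ht_mul 1 1

theorem tr_one : 𝓑.tr 1 = 0 := by
  simpa [𝓑.ht_one] using 𝓑.tr_mul 1 1

theorem ht_pow (a : ℕ) : 𝓑.ht (𝓑.x ^ a) = 0 := by
  induction a with
  | zero => simpa using 𝓑.ht_one
  | succ a ih => rw [pow_succ, 𝓑.ht_mul, ih, 𝓑.ht_x, add_zero]

theorem tr_pow (a : ℕ) : 𝓑.tr (𝓑.x ^ a) = a := by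
  induction a with
  | zero => simpa using 𝓑.tr_one
  | succ a ih => simp [pow_succ, 𝓑.tr_mul, ih, 𝓑.ht_pow, 𝓑.tr_x]

theorem ht_digitWord (l : List (Fin m)) : 𝓑.ht (digitWord 𝓑.x 𝓑.y l) = l.length := by
  induction l with
  | nil => simpa using 𝓑.ht_one
  | cons i l ih =>
    rw [digitWord_cons, 𝓑.ht_mul, 𝓑.ht_mul, ih, 𝓑.ht_pow, 𝓑.ht_y, List.length_cons]
    push_cast
    ring

theorem ht_normalForm (a : ℕ) (l : List (Fin m)) :
    𝓑.ht (𝓑.x ^ a * digitWord 𝓑.x 𝓑.y l) = l.length := by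
  rw [𝓑.ht_mul, 𝓑.ht_pow, 𝓑.ht_digitWord, zero_add]

theorem tr_nonneg {z : G} (hz : z ∈ 𝓑.pos) : 0 ≤ 𝓑.tr z := by
  induction hz using Submonoid.closure_induction with
  | mem z hz =>
    rcases hz with rfl | rfl
    · simp [𝓑.tr_x]
    · simp [𝓑.tr_y]
  | one => rw [𝓑.tr_one]
  | mul z w _ _ hz hw =>
    rw [𝓑.tr_mul]
    positivity

variable {𝓑}

theorem exists_normalForm (hm : 0 < m) {z : G} (hz : z ∈ 𝓑.pos) :
    ∃ (a : ℕ) (l : List (Fin m)), z = 𝓑.x ^ a * digitWord 𝓑.x 𝓑.y l :=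
  exists_eq_pow_mul_digitWord hm 𝓑.rel hz

theorem ht_nonneg (hm : 0 < m) {z : G} (hz : z ∈ 𝓑.pos) : 0 ≤ 𝓑.ht z := by
  obtain ⟨a, l, rfl⟩ := exists_normalForm hm hz
  rw [𝓑.ht_normalForm]
  positivity

theorem exists_eq_pow_of_ht_eq_zero (hm : 0 < m) {z : G} (hz : z ∈ 𝓑.pos) (h : 𝓑.ht z = 0) :
    ∃ a : ℕ, z = 𝓑.x ^ a := by
  obtain ⟨a, l, rfl⟩ := exists_normalForm hm hz
  rw [𝓑.ht_normalForm] at h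
  obtain rfl : l = [] := by simpa using h
  exact ⟨a, by simp⟩

theorem mul_pow_comm (hm : 0 < m) {z : G} (hz : z ∈ 𝓑.pos) (k : ℕ) :
    z * 𝓑.x ^ (k * m ^ (𝓑.ht z).toNat) = 𝓑.x ^ (k * n ^ (𝓑.ht z).toNat) * z := by
  obtain ⟨a, l, rfl⟩ := exists_normalForm hm hz
  rw [𝓑.ht_normalForm, Int.toNat_natCast, mul_assoc, digitWord_mul_pow_mul_pow 𝓑.rel, ← mul_assoc,
    ← mul_assoc, ← pow_add, ← pow_add, Nat.add_comm]

/-- Two left divisors of equal height of the same positive element differ by a power of `x`. -/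
theorem exists_pow_of_mul_eq_mul (hm : 0 < m) {p q r s : G} (hp : p ∈ 𝓑.pos) (hq : q ∈ 𝓑.pos)
    (hr : r ∈ 𝓑.pos) (hs : s ∈ 𝓑.pos) (hpq : 𝓑.ht p = 𝓑.ht q) (h : p * r = q * s) :
    ∃ d : ℕ, q = p * 𝓑.x ^ d ∨ p = q * 𝓑.x ^ d := by
  obtain ⟨a, l, rfl⟩ := exists_normalForm hm hp
  obtain ⟨b, l₁, rfl⟩ := exists_normalForm hm hq
  obtain ⟨c, l₂, rfl⟩ := exists_normalForm hm hr
  obtain ⟨d, l₃, rfl⟩ := exists_normalForm hm hs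
  rw [𝓑.ht_normalForm, 𝓑.ht_normalForm] at hpq
  obtain ⟨f, l', hl', hf⟩ := digitWord_mul_pow hm 𝓑.rel l c
  obtain ⟨f₁, l₁', hl₁', hf₁⟩ := digitWord_mul_pow hm 𝓑.rel l₁ d
  -- Carrying `x ^ c` and `x ^ d` through the left factors brings both products to normal form
  -- without changing the numbers of digits. Equal heights then force the left parts to agree, that
  -- is, `p * x ^ c = q * x ^ d`.
  have e : 𝓑.x ^ (a + f) * digitWord 𝓑.x 𝓑.y (l' ++ l₂) =
      𝓑.x ^ (b + f₁) * digitWord 𝓑.x 𝓑.y (l₁' ++ l₃) := by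
    rw [digitWord_append, digitWord_append, pow_add, pow_add, mul_assoc, mul_assoc,
      ← mul_assoc (𝓑.x ^ f), ← mul_assoc (𝓑.x ^ f₁), ← hf, ← hf₁]
    simpa only [mul_assoc] using h
  obtain ⟨e₁, e₂⟩ := 𝓑.normalForm_inj _ _ _ _ e
  obtain ⟨rfl, -⟩ := List.append_inj e₂ (by omega)
  have e₃ : 𝓑.x ^ a * digitWord 𝓑.x 𝓑.y l * 𝓑.x ^ c =
      𝓑.x ^ b * digitWord 𝓑.x 𝓑.y l₁ * 𝓑.x ^ d := by
    rw [mul_assoc, mul_assoc, hf, hf₁, ← mul_assoc, ← mul_assoc, ← pow_add, ← pow_add, e₁]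
  rcases le_total c d with hcd | hcd
  · obtain ⟨t, rfl⟩ := Nat.exists_eq_add_of_le hcd
    refine ⟨t, Or.inr ?_⟩
    rw [Nat.add_comm, pow_add, ← mul_assoc] at e₃
    exact mul_right_cancel e₃
  · obtain ⟨t, rfl⟩ := Nat.exists_eq_add_of_le hcd
    refine ⟨t, Or.inl ?_⟩
    rw [Nat.add_comm, pow_add, ← mul_assoc] at e₃
    exact (mul_right_cancel e₃).symm

/-- The elements `digitWord x y l` for lists `l` of length at most `H`. -/
def shortWords (𝓑 : BSModel m n G) (H : ℕ) : Set G :=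
  digitWord 𝓑.x 𝓑.y '' {l : List (Fin m) | l.length ≤ H}

/-- Cutting the normal form of `q` at the height of `p` leaves a tail consisting of digits only,
hence one of finitely many. -/
theorem exists_split (hm : 0 < m) {p q : G} {H : ℕ} (hp : p ∈ 𝓑.pos) (hq : q ∈ 𝓑.pos)
    (h₁ : 𝓑.ht p ≤ 𝓑.ht q) (h₂ : 𝓑.ht q ≤ 𝓑.ht p + H) :
    ∃ q₁ ∈ 𝓑.pos, ∃ q₂ ∈ 𝓑.shortWords H, q = q₁ * q₂ ∧ 𝓑.ht q₁ = 𝓑.ht p := by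
  obtain ⟨a, l, rfl⟩ := exists_normalForm hm hp
  obtain ⟨b, l', rfl⟩ := exists_normalForm hm hq
  rw [𝓑.ht_normalForm, 𝓑.ht_normalForm] at h₁ h₂
  refine ⟨𝓑.x ^ b * digitWord 𝓑.x 𝓑.y (l'.take l.length),
    mul_mem (pow_mem_closure_pair _ _ _) (digitWord_mem_closure_pair _ _ _), _,
    ⟨l'.drop l.length, ?_, rfl⟩, ?_, ?_⟩
  · simp only [Set.mem_ofPred_eq, List.length_drop]
    omega
  · rw [mul_assoc, ← digitWord_append, List.take_append_drop]
  · rw [𝓑.ht_normalForm, 𝓑.ht_normalForm, List.length_take]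
    norm_cast at h₁ ⊢
    omega

theorem shortWords_subset (𝓑 : BSModel m n G) (H : ℕ) {z : G} (hz : z ∈ 𝓑.shortWords H) :
    z ∈ 𝓑.pos := by
  obtain ⟨l, -, rfl⟩ := hz
  exact digitWord_mem_closure_pair _ _ _

/-- The differences of left divisors that can occur for elements of bounded relative length. -/
def differences (𝓑 : BSModel m n G) (H D : ℕ) : Set G :=
  Set.image2 (fun (z : ℤ) f => 𝓑.x ^ z * f) (Set.Icc (-D) D) (𝓑.shortWords H)

theorem finite_differences (𝓑 : BSModel m n G) (H D : ℕ) : (𝓑.differences H D).Finite :=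
  (Set.finite_Icc _ _).image2 _ ((List.finite_length_le _ H).image _)

/-- After `q` is cut at the height of `p`, the two left divisors differ by `x ^ d`, which shifts
`tr` by `λ ^ ht p * d`. Both values of `tr` are nonnegative and at most `C * λ ^ (ht p + H)`, so `d
≤ C * λ ^ H`. -/
theorem inv_mul_mem_differences (hm : 0 < m) (hmn : m < n) {H D : ℕ} {C : ℚ} {p q r s : G}
    (hp : p ∈ 𝓑.pos) (hq : q ∈ 𝓑.pos) (hr : r ∈ 𝓑.pos) (hs : s ∈ 𝓑.pos) (hC : 0 ≤ C)
    (h₁ : 𝓑.ht p ≤ 𝓑.ht q) (h₂ : 𝓑.ht q ≤ 𝓑.ht p + H) (h : p * r = q * s)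
    (hpC : 𝓑.tr p ≤ C * ((n : ℚ) / m) ^ 𝓑.ht p) (hqC : 𝓑.tr q ≤ C * ((n : ℚ) / m) ^ 𝓑.ht q)
    (hD : C * ((n : ℚ) / m) ^ H ≤ D) :
    p⁻¹ * q ∈ 𝓑.differences H D := by
  have hm' : (0 : ℚ) < m := by exact_mod_cast hm
  have hlam : (1 : ℚ) < n / m := by
    rw [one_lt_div hm']
    exact_mod_cast hmn
  have hlam0 : (0 : ℚ) < n / m := one_pos.trans hlam
  obtain ⟨q₁, hq₁, q₂, hq₂, rfl, hht⟩ := exists_split hm hp hq h₁ h₂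
  have hq₂' := 𝓑.shortWords_subset H hq₂
  have hpos : (0 : ℚ) < ((n : ℚ) / m) ^ 𝓑.ht p := zpow_pos hlam0 _
  obtain ⟨d, hd⟩ := exists_pow_of_mul_eq_mul hm hp hq₁ hr (mul_mem hq₂' hs) hht.symm
    (by rw [h, mul_assoc])
  have hbound : ((n : ℚ) / m) ^ 𝓑.ht p * d ≤ ((n : ℚ) / m) ^ 𝓑.ht p * D := by
    rcases hd with hd | hd
    · have e : 𝓑.tr q₁ = 𝓑.tr p + ((n : ℚ) / m) ^ 𝓑.ht p * d := by
        rw [hd, 𝓑.tr_mul, 𝓑.tr_pow]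
      have h3 := 𝓑.tr_nonneg hp
      have h4 : 𝓑.tr q₁ ≤ 𝓑.tr (q₁ * q₂) := by
        rw [𝓑.tr_mul]
        have := 𝓑.tr_nonneg hq₂'
        have : (0 : ℚ) ≤ ((n : ℚ) / m) ^ 𝓑.ht q₁ := by positivity
        nlinarith
      have h5 : ((n : ℚ) / m) ^ 𝓑.ht (q₁ * q₂) ≤ ((n : ℚ) / m) ^ 𝓑.ht p * (n / m) ^ H := by
        rw [← zpow_natCast, ← zpow_add₀ hlam0.ne']
        exact zpow_le_zpow_right₀ hlam.le h₂
      calc ((n : ℚ) / m) ^ 𝓑.ht p * d ≤ 𝓑.tr (q₁ * q₂) := by linarith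
        _ ≤ C * (((n : ℚ) / m) ^ 𝓑.ht p * (n / m) ^ H) :=
          hqC.trans (mul_le_mul_of_nonneg_left h5 hC)
        _ = ((n : ℚ) / m) ^ 𝓑.ht p * (C * (n / m) ^ H) := by ring
        _ ≤ _ := mul_le_mul_of_nonneg_left hD hpos.le
    · have e : 𝓑.tr p = 𝓑.tr q₁ + ((n : ℚ) / m) ^ 𝓑.ht p * d := by
        rw [hd, 𝓑.tr_mul, 𝓑.tr_pow, 𝓑.ht_mul, 𝓑.ht_pow, add_zero]
      have h3 := 𝓑.tr_nonneg hq₁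
      have h4 : C ≤ D := le_trans (le_mul_of_one_le_right hC (one_le_pow₀ hlam.le)) hD
      calc ((n : ℚ) / m) ^ 𝓑.ht p * d ≤ C * ((n : ℚ) / m) ^ 𝓑.ht p := by linarith
        _ = ((n : ℚ) / m) ^ 𝓑.ht p * C := mul_comm _ _
        _ ≤ _ := mul_le_mul_of_nonneg_left h4 hpos.le
  have hdD : d ≤ D := by
    have := le_of_mul_le_mul_left hbound hpos
    exact_mod_cast this
  rcases hd with rfl | rfl
  · exact ⟨d, by simp; omega, q₂, hq₂, by simp [mul_assoc]⟩
  · exact ⟨-d, by simp; omega, q₂, hq₂, by simp [mul_assoc]⟩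

end BSModel

/-! ### Rewriting words into blocks, and the case `m < n` -/

namespace BSModel

variable {m n : ℕ} {G : Type} [Group G] {𝓑 : BSModel m n G} {A : Type} {g : A → G}

theorem lift_mem_pos (hg : ∀ a, g a ∈ 𝓑.pos) (w : FreeMonoid A) : FreeMonoid.lift g w ∈ 𝓑.pos := by
  induction w using FreeMonoid.inductionOn' with
  | one => exact one_mem _
  | of_mul a w ih =>
    rw [map_mul, FreeMonoid.lift_eval_of]
    exact mul_mem (hg a) ih

/-- Up to a power of a single word `κ`, there are only finitely many products of generators that
are powers of `x`. -/
theorem exists_tails (hm : 0 < m) (hg : ∀ a, g a ∈ 𝓑.pos) :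
    ∃ (κ : FreeMonoid A) (k : ℕ) (E : Set (FreeMonoid A)), FreeMonoid.lift g κ = 𝓑.x ^ k ∧
      (k = 0 → κ = 1) ∧ E.Finite ∧ 1 ∈ E ∧ (∀ e ∈ E, 𝓑.ht (FreeMonoid.lift g e) = 0) ∧
      ∀ e ∈ E, ∀ a, 𝓑.ht (g a) = 0 → ∃ e' ∈ E, ∃ N : ℕ,
        FreeMonoid.lift g (e * FreeMonoid.of a) = FreeMonoid.lift g (e' * κ ^ N) := by
  classical
  by_cases h : ∃ a, ∃ k : ℕ, 0 < k ∧ g a = 𝓑.x ^ k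
  · obtain ⟨a₀, k, hk, hak⟩ := h
    let P : Set ℕ := {c | ∃ w, FreeMonoid.lift g w = 𝓑.x ^ c}
    have hch : ∀ c : ℕ, ∃ w, c ∈ P → FreeMonoid.lift g w = 𝓑.x ^ c := by
      intro c
      by_cases hc : c ∈ P
      · exact ⟨hc.choose, fun _ => hc.choose_spec⟩
      · exact ⟨1, fun h => (hc h).elim⟩
    choose w hw using hch
    -- The least attained exponent in each residue class mod `k`; any other attained exponent in the
    -- class exceeds it by a multiple of `k`. For an empty class `sInf` returns 0, which is attained
    -- by the empty word.
    let c : ℕ → ℕ := fun i => sInf {c | c ∈ P ∧ c % k = i}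
    have hc : ∀ i, c i ∈ P := by
      intro i
      rcases Set.eq_empty_or_nonempty {c | c ∈ P ∧ c % k = i} with h | h
      · have : c i = 0 := by simp only [c, h, Nat.sInf_empty]
        rw [this]
        exact ⟨1, by simp⟩
      · exact (Nat.sInf_mem h).1
    have hE : ∀ e ∈ insert 1 ((fun i => w (c i)) '' Set.Iio k),
        ∃ t : ℕ, FreeMonoid.lift g e = 𝓑.x ^ t := by
      rintro _ (rfl | ⟨i, -, rfl⟩)
      · exact ⟨0, by simp⟩
      · exact ⟨_, hw _ (hc i)⟩
    refine ⟨FreeMonoid.of a₀, k, insert 1 ((fun i => w (c i)) '' Set.Iio k), by simpa using hak,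
      fun h => by omega, ((Set.finite_Iio k).image _).insert _, Set.mem_insert _ _, ?_, ?_⟩
    · intro e he
      obtain ⟨t, ht⟩ := hE e he
      rw [ht, 𝓑.ht_pow]
    · intro e he a ha
      obtain ⟨t, ht⟩ := hE e he
      obtain ⟨j, hj⟩ := exists_eq_pow_of_ht_eq_zero hm (hg a) ha
      have hs : FreeMonoid.lift g (e * FreeMonoid.of a) = 𝓑.x ^ (t + j) := by
        rw [map_mul, FreeMonoid.lift_eval_of, ht, hj, pow_add]
      have hmem : t + j ∈ {c | c ∈ P ∧ c % k = (t + j) % k} := ⟨⟨_, hs⟩, rfl⟩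
      have hle : c ((t + j) % k) ≤ t + j := Nat.sInf_le hmem
      have hmod : c ((t + j) % k) % k = (t + j) % k := (Nat.sInf_mem ⟨_, hmem⟩).2
      obtain ⟨N, hN⟩ := (Nat.modEq_iff_dvd' hle).1 hmod
      refine ⟨_, Set.mem_insert_of_mem _ ⟨(t + j) % k, Nat.mod_lt _ hk, rfl⟩, N, ?_⟩
      rw [hs, map_mul, map_pow, FreeMonoid.lift_eval_of, hw _ (hc _), hak, ← pow_mul, ← pow_add]
      congr 1
      omega
  -- Here every generator of height 0 equals 1, so no tail is needed.
  · push Not at h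
    refine ⟨1, 0, {1}, by simp, fun _ => rfl, Set.finite_singleton _, rfl, ?_, ?_⟩
    · rintro _ rfl
      rw [map_one, 𝓑.ht_one]
    · rintro _ rfl a ha
      obtain ⟨j, hj⟩ := exists_eq_pow_of_ht_eq_zero hm (hg a) ha
      refine ⟨1, rfl, 0, ?_⟩
      rcases Nat.eq_zero_or_pos j with rfl | hj0
      · simpa using hj
      · exact (h a j hj0 hj).elim

/-- The words of the form `e * κ ^ R * a`, for `a` a letter of positive height. -/
def blocks (𝓑 : BSModel m n G) (g : A → G) (κ : FreeMonoid A) (E : Set (FreeMonoid A)) :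
    Set (FreeMonoid A) :=
  ⋃ a ∈ {a | 0 < 𝓑.ht (g a)},
    Set.image2 (fun e R => e * κ ^ R * FreeMonoid.of a) E (Set.Iio (n ^ (𝓑.ht (g a)).toNat))

theorem finite_blocks [Finite A] (𝓑 : BSModel m n G) (g : A → G) (κ : FreeMonoid A)
    {E : Set (FreeMonoid A)} (hE : E.Finite) : (𝓑.blocks g κ E).Finite :=
  (Set.toFinite _).biUnion fun _ _ => hE.image2 _ (Set.finite_Iio _)

/-- Finitely many relations suffice to write every word as a product of blocks followed by an
element of `E` and a power of `κ`. -/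
theorem exists_finite_rewriting [Finite A] (hm : 0 < m) (hn : 0 < n) (hg : ∀ a, g a ∈ 𝓑.pos)
    {κ : FreeMonoid A} {k : ℕ} {E : Set (FreeMonoid A)} (hκ : FreeMonoid.lift g κ = 𝓑.x ^ k)
    (hE : E.Finite) (h1 : 1 ∈ E)
    (hEa : ∀ e ∈ E, ∀ a, 𝓑.ht (g a) = 0 → ∃ e' ∈ E, ∃ N : ℕ,
        FreeMonoid.lift g (e * FreeMonoid.of a) = FreeMonoid.lift g (e' * κ ^ N)) :
    ∃ ρ : Set (FreeMonoid A × FreeMonoid A), ρ.Finite ∧ SatisfiesRel g ρ ∧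
      ∀ u : FreeMonoid A, ∃ L : List (FreeMonoid A), (∀ b ∈ L, b ∈ 𝓑.blocks g κ E) ∧
        ∃ e ∈ E, ∃ N : ℕ, ∀ (K : Type) [Group K] (k : A → K), SatisfiesRel k ρ →
          FreeMonoid.lift k u = FreeMonoid.lift k (L.prod * e * κ ^ N) := by
  have hch : ∀ (e : FreeMonoid A) (a : A), ∃ (e' : FreeMonoid A) (N : ℕ), e ∈ E → 𝓑.ht (g a) = 0 →
      e' ∈ E ∧ FreeMonoid.lift g (e * FreeMonoid.of a) = FreeMonoid.lift g (e' * κ ^ N) := by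
    intro e a
    by_cases h : e ∈ E ∧ 𝓑.ht (g a) = 0
    · obtain ⟨e', he', N, hN⟩ := hEa e h.1 a h.2
      exact ⟨e', N, fun _ _ => ⟨he', hN⟩⟩
    · exact ⟨1, 0, fun h₁ h₂ => (h ⟨h₁, h₂⟩).elim⟩
  choose T N hTN using hch
  let h : A → ℕ := fun a => (𝓑.ht (g a)).toNat
  -- The first family moves powers of `κ` rightwards across a letter; the second absorbs a letter of
  -- height 0 into the tail.
  let ρ : Set (FreeMonoid A × FreeMonoid A) :=
    Set.range (fun a => (κ ^ n ^ h a * FreeMonoid.of a, FreeMonoid.of a * κ ^ m ^ h a)) ∪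
    Set.image2 (fun e a => (e * FreeMonoid.of a, T e a * κ ^ N e a)) E {a | 𝓑.ht (g a) = 0}
  refine ⟨ρ, (Set.finite_range _).union (hE.image2 _ (Set.toFinite _)), ?_, ?_⟩
  · rintro _ (⟨a, rfl⟩ | ⟨e, he, a, ha, rfl⟩)
    · simp only [map_mul, map_pow, hκ, FreeMonoid.lift_eval_of, ← pow_mul]
      exact (mul_pow_comm hm (hg a) k).symm
    · exact (hTN e a he ha).2
  · suffices H : ∀ l : List A, ∃ L : List (FreeMonoid A), (∀ b ∈ L, b ∈ 𝓑.blocks g κ E) ∧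
        ∃ e ∈ E, ∃ N : ℕ, ∀ (K : Type) [Group K] (k : A → K), SatisfiesRel k ρ →
          FreeMonoid.lift k (FreeMonoid.ofList l) = FreeMonoid.lift k (L.prod * e * κ ^ N) from
      fun u => H u.toList
    intro l
    induction l using List.reverseRecOn with
    | nil => exact ⟨[], by simp, 1, h1, 0, fun K _ k _ => by simp⟩
    | append_singleton l a ih =>
      obtain ⟨L, hL, e, he, M, ih⟩ := ih
      have hsemi : ∀ (K : Type) [Group K] (k : A → K), SatisfiesRel k ρ → ∀ Q : ℕ,
          FreeMonoid.lift k κ ^ (n ^ h a * Q) * k a =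
            k a * FreeMonoid.lift k κ ^ (m ^ h a * Q) := by
        intro K _ k hk Q
        have h2 := hk _ (Or.inl ⟨a, rfl⟩)
        simp only [map_mul, map_pow, FreeMonoid.lift_eval_of] at h2
        have h3 : SemiconjBy (k a) (FreeMonoid.lift k κ ^ m ^ h a)
          (FreeMonoid.lift k κ ^ n ^ h a) := h2.symm
        have h4 := (h3.pow_right Q).eq
        rw [pow_mul, pow_mul, h4]
      rcases (ht_nonneg hm (hg a)).eq_or_lt with h0 | h0
      · refine ⟨L, hL, T e a, (hTN e a he h0.symm).1, N e a + M, fun K _ k hk => ?_⟩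
        have h5 := hsemi K k hk M
        have h6 := hk _ (Or.inr ⟨e, he, a, h0.symm, rfl⟩)
        have h7 : h a = 0 := by simp [h, ← h0]
        simp only [map_mul, map_pow, FreeMonoid.lift_eval_of, h7, pow_zero, one_mul] at h5 h6
        rw [FreeMonoid.ofList_append, FreeMonoid.ofList_singleton, map_mul, ih K k hk]
        simp only [map_mul, map_pow, FreeMonoid.lift_eval_of]
        rw [mul_assoc, h5, pow_add, ← mul_assoc, mul_assoc _ _ (k a), h6]
        simp only [mul_assoc]
      -- The exponent of `κ` is divided by `n ^ h a`: the remainder stays in the new block, which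
      -- bounds the block, and the quotient crosses the letter.
      · refine ⟨L ++ [e * κ ^ (M % n ^ h a) * FreeMonoid.of a], ?_, 1, h1, m ^ h a * (M / n ^ h a),
          fun K _ k hk => ?_⟩
        · intro b hb
          rcases List.mem_append.1 hb with hb | hb
          · exact hL b hb
          · rw [List.mem_singleton.1 hb]
            exact Set.mem_biUnion h0 ⟨e, he, _, Nat.mod_lt _ (pow_pos hn _), rfl⟩
        · have h5 := hsemi K k hk (M / n ^ h a)
          have h6 : FreeMonoid.lift k κ ^ M = FreeMonoid.lift k κ ^ (M % n ^ h a) *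
              FreeMonoid.lift k κ ^ (n ^ h a * (M / n ^ h a)) := by
            rw [← pow_add, Nat.mod_add_div]
          rw [FreeMonoid.ofList_append, FreeMonoid.ofList_singleton, map_mul, ih K k hk]
          simp only [map_mul, map_pow, FreeMonoid.lift_eval_of, List.prod_append,
            List.prod_singleton, mul_one]
          rw [h6]
          simp only [mul_assoc]
          rw [h5]

theorem ht_pos_of_mem_blocks (hm : 0 < m) (hg : ∀ a, g a ∈ 𝓑.pos) {κ : FreeMonoid A}
    {E : Set (FreeMonoid A)} {b : FreeMonoid A} (hb : b ∈ 𝓑.blocks g κ E) :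
    0 < 𝓑.ht (FreeMonoid.lift g b) := by
  obtain ⟨a, ha, e, -, R, -, rfl⟩ := Set.mem_iUnion₂.1 hb
  rw [map_mul, 𝓑.ht_mul, FreeMonoid.lift_eval_of]
  exact add_pos_of_nonneg_of_pos (ht_nonneg hm (lift_mem_pos hg _)) ha

/-- Appending a block adds at most `β * λ ^ ht` and raises the height by at least 1. The constant `C
= β / (λ - 1)` is the solution of `C + β = C * λ`, so the bound reproduces itself. -/
theorem tr_prod_le (hm : 0 < m) (hmn : m < n) {B : Set (FreeMonoid A)} {β : ℚ} (hβ : 0 ≤ β)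
    (hB : ∀ b ∈ B, 0 < 𝓑.ht (FreeMonoid.lift g b))
    (hBβ : ∀ b ∈ B, 𝓑.tr (FreeMonoid.lift g b) ≤ β) (L : List (FreeMonoid A))
    (hL : ∀ b ∈ L, b ∈ B) :
    𝓑.tr (FreeMonoid.lift g L.prod) ≤
      β / ((n : ℚ) / m - 1) * ((n : ℚ) / m) ^ 𝓑.ht (FreeMonoid.lift g L.prod) := by
  have hm' : (0 : ℚ) < m := by exact_mod_cast hm
  have hlam : (1 : ℚ) < n / m := by
    rw [one_lt_div hm']
    exact_mod_cast hmn
  set lam : ℚ := n / m with hlam_def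
  have hlam0 : (0 : ℚ) < lam := one_pos.trans hlam
  have hC : 0 ≤ β / (lam - 1) := div_nonneg hβ (by linarith)
  have hCβ : β / (lam - 1) + β = β / (lam - 1) * lam := by
    have : lam - 1 ≠ 0 := by linarith
    field_simp
    ring
  induction L using List.reverseRecOn with
  | nil => simpa [𝓑.ht_one, 𝓑.tr_one] using hC
  | append_singleton L b ih =>
    have ih := ih fun c hc => hL c (by simp [hc])
    have hb : b ∈ B := hL b (by simp)
    have h1 := hB b hb
    have h2 := hBβ b hb
    rw [List.prod_append, List.prod_singleton, map_mul, 𝓑.tr_mul, 𝓑.ht_mul, zpow_add₀ hlam0.ne',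
      ← hlam_def]
    have h3 : lam ≤ lam ^ 𝓑.ht (FreeMonoid.lift g b) := by
      simpa using zpow_le_zpow_right₀ hlam.le (show (1 : ℤ) ≤ _ from h1)
    have h4 : 0 < lam ^ 𝓑.ht (FreeMonoid.lift g L.prod) := zpow_pos hlam0 _
    set t := lam ^ 𝓑.ht (FreeMonoid.lift g L.prod)
    calc _ ≤ β / (lam - 1) * t + t * β := add_le_add ih (mul_le_mul_of_nonneg_left h2 h4.le)
      _ = t * (β / (lam - 1) + β) := by ring
      _ = β / (lam - 1) * t * lam := by rw [hCβ]; ring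
      _ ≤ β / (lam - 1) * t * lam ^ 𝓑.ht (FreeMonoid.lift g b) :=
        mul_le_mul_of_nonneg_left h3 (mul_nonneg hC h4.le)
      _ = _ := by ring

/-- Removing the last block of the product of greater height keeps the two heights within `H` of
each other, so the difference remains in the finite set throughout. The empty word in `B'` lets one
side advance alone. -/
theorem fellowTravel_prod (hm : 0 < m) (hmn : m < n) (hg : ∀ a, g a ∈ 𝓑.pos)
    {B B' : Set (FreeMonoid A)} {F : Set G} {β : ℚ} {H D : ℕ} (hβ : 0 ≤ β)
    (hB : ∀ b ∈ B, 0 < 𝓑.ht (FreeMonoid.lift g b))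
    (hBH : ∀ b ∈ B, 𝓑.ht (FreeMonoid.lift g b) ≤ H)
    (hBβ : ∀ b ∈ B, 𝓑.tr (FreeMonoid.lift g b) ≤ β)
    (hD : β / ((n : ℚ) / m - 1) * ((n : ℚ) / m) ^ H ≤ D)
    (hF : ∀ d ∈ 𝓑.differences H D, d ∈ F ∧ d⁻¹ ∈ F) (h1 : 1 ∈ B') (hBB' : B ⊆ B') :
    ∀ (N : ℕ) (L L' : List (FreeMonoid A)), L.length + L'.length = N → (∀ b ∈ L, b ∈ B) →
      (∀ b ∈ L', b ∈ B) →
      𝓑.ht (FreeMonoid.lift g L.prod) ≤ 𝓑.ht (FreeMonoid.lift g L'.prod) + H →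
      𝓑.ht (FreeMonoid.lift g L'.prod) ≤ 𝓑.ht (FreeMonoid.lift g L.prod) + H →
      (∃ r s, FreeMonoid.lift g (L.prod * r) = FreeMonoid.lift g (L'.prod * s)) →
      FellowTravel g F B' L.prod L'.prod := by
  have hC : 0 ≤ β / ((n : ℚ) / m - 1) := by
    refine div_nonneg hβ (sub_nonneg.2 ?_)
    rw [one_le_div (by exact_mod_cast hm)]
    exact_mod_cast hmn.le
  have hdiff : ∀ L L' : List (FreeMonoid A), (∀ b ∈ L, b ∈ B) → (∀ b ∈ L', b ∈ B) →
      𝓑.ht (FreeMonoid.lift g L.prod) ≤ 𝓑.ht (FreeMonoid.lift g L'.prod) →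
      𝓑.ht (FreeMonoid.lift g L'.prod) ≤ 𝓑.ht (FreeMonoid.lift g L.prod) + H →
      (∃ r s, FreeMonoid.lift g (L.prod * r) = FreeMonoid.lift g (L'.prod * s)) →
      (FreeMonoid.lift g L.prod)⁻¹ * FreeMonoid.lift g L'.prod ∈ 𝓑.differences H D := by
    rintro L L' hL hL' h₁ h₂ ⟨r, s, hrs⟩
    rw [map_mul, map_mul] at hrs
    exact inv_mul_mem_differences hm hmn (lift_mem_pos hg _) (lift_mem_pos hg _)
      (lift_mem_pos hg r) (lift_mem_pos hg s) hC h₁ h₂ hrs (tr_prod_le hm hmn hβ hB hBβ L hL)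
      (tr_prod_le hm hmn hβ hB hBβ L' hL') hD
  have hmem : ∀ L L' : List (FreeMonoid A), (∀ b ∈ L, b ∈ B) → (∀ b ∈ L', b ∈ B) →
      𝓑.ht (FreeMonoid.lift g L.prod) ≤ 𝓑.ht (FreeMonoid.lift g L'.prod) + H →
      𝓑.ht (FreeMonoid.lift g L'.prod) ≤ 𝓑.ht (FreeMonoid.lift g L.prod) + H →
      (∃ r s, FreeMonoid.lift g (L.prod * r) = FreeMonoid.lift g (L'.prod * s)) →
      (FreeMonoid.lift g L.prod)⁻¹ * FreeMonoid.lift g L'.prod ∈ F := by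
    rintro L L' hL hL' h₁ h₂ ⟨r, s, hrs⟩
    rcases le_total (𝓑.ht (FreeMonoid.lift g L.prod)) (𝓑.ht (FreeMonoid.lift g L'.prod)) with h | h
    · exact (hF _ (hdiff L L' hL hL' h h₂ ⟨r, s, hrs⟩)).1
    · simpa using (hF _ (hdiff L' L hL' hL h h₁ ⟨s, r, hrs.symm⟩)).2
  have hprod : ∀ (L : List (FreeMonoid A)), (∀ b ∈ L, b ∈ B) → L ≠ [] →
      ∃ (L₁ : List (FreeMonoid A)) (b : FreeMonoid A), L = L₁ ++ [b] ∧ b ∈ B ∧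
        (∀ b ∈ L₁, b ∈ B) ∧ L.prod = L₁.prod * b := by
    intro L hL hne
    rcases List.eq_nil_or_concat L with h | ⟨L₁, b, h⟩
    · exact (hne h).elim
    · rw [List.concat_eq_append] at h
      subst h
      exact ⟨L₁, b, rfl, hL b (by simp), fun c hc => hL c (by simp [hc]), by simp⟩
  intro N
  induction N with
  | zero =>
    intro L L' hlen _ _ _ _ _
    obtain ⟨rfl, rfl⟩ : L = [] ∧ L' = [] := by
      rw [← List.length_eq_zero_iff, ← List.length_eq_zero_iff]
      omega
    exact FellowTravel.one
  | succ N ih =>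
    intro L L' hlen hL hL' h₁ h₂ hrs
    have hF' := hmem L L' hL hL' h₁ h₂ hrs
    obtain ⟨r, s, hrs⟩ := hrs
    -- The product of greater or equal height has a block to remove, since blocks have positive
    -- height and the two lists are not both empty.
    have hne : ∀ M M' : List (FreeMonoid A), M.length + M'.length = N + 1 → (∀ b ∈ M', b ∈ B) →
        𝓑.ht (FreeMonoid.lift g M'.prod) ≤ 𝓑.ht (FreeMonoid.lift g M.prod) → M ≠ [] := by
      rintro M M' hlen hM' hle rfl
      obtain ⟨M₁, b, rfl, hb, -, hp⟩ := hprod M' hM' (by rintro rfl; simp at hlen)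
      rw [hp, map_mul, 𝓑.ht_mul, List.prod_nil, map_one, 𝓑.ht_one] at hle
      have := hB b hb
      have := ht_nonneg hm (lift_mem_pos hg M₁.prod)
      omega
    rcases le_total (𝓑.ht (FreeMonoid.lift g L'.prod)) (𝓑.ht (FreeMonoid.lift g L.prod)) with h | h
    · obtain ⟨L₁, b, rfl, hb, hL₁, hp⟩ := hprod L hL (hne L L' hlen hL' h)
      rw [hp] at hrs h h₁ h₂ hF' ⊢
      have e : 𝓑.ht (FreeMonoid.lift g (L₁.prod * b)) =
        𝓑.ht (FreeMonoid.lift g L₁.prod) + 𝓑.ht (FreeMonoid.lift g b) := by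
        rw [map_mul, 𝓑.ht_mul]
      have := hB b hb
      have := hBH b hb
      rw [List.length_append, List.length_singleton] at hlen
      have hft := ih L₁ L' (by omega) hL₁ hL' (by omega) (by omega)
        ⟨b * r, s, by rw [← mul_assoc, hrs]⟩
      have := FellowTravel.step (F := F) hft (hBB' hb) h1 (by rwa [mul_one])
        ⟨r, s, by rwa [mul_one]⟩
      rwa [mul_one] at this
    · obtain ⟨L₁, b, rfl, hb, hL₁, hp⟩ := hprod L' hL' (hne L' L (by omega) hL h)
      rw [hp] at hrs h h₁ h₂ hF' ⊢
      have e : 𝓑.ht (FreeMonoid.lift g (L₁.prod * b)) =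
        𝓑.ht (FreeMonoid.lift g L₁.prod) + 𝓑.ht (FreeMonoid.lift g b) := by
        rw [map_mul, 𝓑.ht_mul]
      have := hB b hb
      have := hBH b hb
      rw [List.length_append, List.length_singleton] at hlen
      have hft := ih L L₁ (by omega) hL hL₁ (by omega) (by omega)
        ⟨r, b * s, by rw [← mul_assoc, hrs]⟩
      have := FellowTravel.step (F := F) hft h1 (hBB' hb) (by rwa [mul_one])
        ⟨r, s, by rwa [mul_one]⟩
      rwa [mul_one] at this

/-- Both words are rewritten as blocks followed by a tail. The common power of `κ` cancels in both
groups, and the surviving power is bounded by comparing `tr`, so it fits into one last step of the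
parallel reading. -/
theorem hasFiniteRelators [Finite A] (hm : 0 < m) (hmn : m < n) (hg : ∀ a, g a ∈ 𝓑.pos) :
    HasFiniteRelators g := by
  obtain ⟨κ, k, E, hκ, hk0, hE, h1, hE0, hEa⟩ := exists_tails hm hg
  obtain ⟨ρ₂, hρ₂, hgρ₂, hrew⟩ := exists_finite_rewriting hm (hm.trans hmn) hg hκ hE h1 hEa
  have hbd : ∀ (f : FreeMonoid A → ℚ) {S : Set (FreeMonoid A)}, S.Finite →
      ∃ c : ℕ, ∀ b ∈ S, f b ≤ c := by
    intro f S hS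
    obtain ⟨c, hc⟩ := (hS.image f).bddAbove
    obtain ⟨c', hc'⟩ := exists_nat_ge c
    exact ⟨c', fun b hb => (hc ⟨b, hb, rfl⟩).trans hc'⟩
  have hBfin := 𝓑.finite_blocks g κ hE
  have hBpos : ∀ b ∈ 𝓑.blocks g κ E, 0 < 𝓑.ht (FreeMonoid.lift g b) :=
    fun b hb => ht_pos_of_mem_blocks hm hg hb
  obtain ⟨β, hβ⟩ := hbd (fun b => 𝓑.tr (FreeMonoid.lift g b)) hBfin
  obtain ⟨H, hH⟩ := hbd (fun b => 𝓑.ht (FreeMonoid.lift g b)) hBfin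
  obtain ⟨ε, hε⟩ := hbd (fun b => 𝓑.tr (FreeMonoid.lift g b)) hE
  obtain ⟨D, hD⟩ := exists_nat_ge ((β : ℚ) / ((n : ℚ) / m - 1) * ((n : ℚ) / m) ^ H)
  obtain ⟨M, hM⟩ := exists_nat_ge ((β : ℚ) / ((n : ℚ) / m - 1) + ε)
  have hlam0 : (0 : ℚ) < n / m := div_pos (by exact_mod_cast hm.trans hmn) (by exact_mod_cast hm)
  let F : Set G := insert 1 (𝓑.differences H D ∪ (𝓑.differences H D)⁻¹)
  let B' : Set (FreeMonoid A) := insert 1 (𝓑.blocks g κ E ∪ (E ∪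
    Set.image2 (fun e N => e * κ ^ N) E (Set.Iic M)))
  have hFfin : F.Finite :=
    ((𝓑.finite_differences H D).union (𝓑.finite_differences H D).inv).insert _
  have hB'fin : B'.Finite :=
    (hBfin.union (hE.union (hE.image2 _ (Set.finite_Iic _)))).insert _
  obtain ⟨ρ₁, hρ₁, hgρ₁, hft⟩ := exists_finite_relators_of_fellowTravel g hFfin hB'fin
  refine ⟨ρ₁ ∪ ρ₂, hρ₁.union hρ₂, fun p hp => hp.elim (hgρ₁ p) (hgρ₂ p), ?_⟩
  intro K _ f hf u v huv
  have hf₁ : SatisfiesRel f ρ₁ := fun p hp => hf p (Or.inl hp)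
  have hf₂ : SatisfiesRel f ρ₂ := fun p hp => hf p (Or.inr hp)
  have key : ∀ L L' : List (FreeMonoid A), (∀ b ∈ L, b ∈ 𝓑.blocks g κ E) →
      (∀ b ∈ L', b ∈ 𝓑.blocks g κ E) → ∀ e ∈ E, ∀ e' ∈ E, ∀ N : ℕ,
      FreeMonoid.lift g (L.prod * e) = FreeMonoid.lift g (L'.prod * (e' * κ ^ N)) →
      FreeMonoid.lift f (L.prod * e) = FreeMonoid.lift f (L'.prod * (e' * κ ^ N)) := by
    intro L L' hL hL' e he e' he' N h
    have h' := h
    simp only [map_mul, map_pow, hκ, ← pow_mul] at h'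
    have hht := congrArg 𝓑.ht h'
    simp only [𝓑.ht_mul, hE0 e he, hE0 e' he', 𝓑.ht_pow, add_zero] at hht
    -- If `k = 0` then `κ` is the empty word. Otherwise `x ^ (k * N)` contributes `k * N` times `λ ^
    -- ht` to `tr`, while the other side has `tr` at most `(C + ε) * λ ^ ht`.
    have hc : e' * κ ^ N ∈ B' := by
      refine Set.mem_insert_of_mem _ (Or.inr ?_)
      rcases Nat.eq_zero_or_pos k with hk | hk
      · rw [hk0 hk, one_pow, mul_one]
        exact Or.inl he'
      · refine Or.inr ⟨e', he', N, ?_, rfl⟩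
        have h2 := congrArg 𝓑.tr h'
        simp only [𝓑.tr_mul, 𝓑.tr_pow, hE0 e' he', zpow_zero, one_mul, ← hht] at h2
        have h3 := tr_prod_le hm hmn (Nat.cast_nonneg β) hBpos hβ L hL
        have h4 := hε e he
        have h5 := 𝓑.tr_nonneg (lift_mem_pos hg e')
        have h6 := 𝓑.tr_nonneg (lift_mem_pos hg L'.prod)
        have h7 : (0 : ℚ) < ((n : ℚ) / m) ^ 𝓑.ht (FreeMonoid.lift g L.prod) := zpow_pos hlam0 _
        generalize ((n : ℚ) / m) ^ 𝓑.ht (FreeMonoid.lift g L.prod) = t at h2 h3 h7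
        have h8 : t * (k * N : ℕ) ≤ t * M := by
          calc t * (k * N : ℕ) ≤ β / ((n : ℚ) / m - 1) * t + t * ε := by
                have := mul_le_mul_of_nonneg_left h4 h7.le
                have := mul_nonneg h7.le h5
                linarith
            _ = t * (β / ((n : ℚ) / m - 1) + ε) := by ring
            _ ≤ _ := mul_le_mul_of_nonneg_left hM h7.le
        have h9 : k * N ≤ M := by exact_mod_cast le_of_mul_le_mul_left h8 h7
        exact le_trans (Nat.le_mul_of_pos_left N hk) h9
    have hpath : FellowTravel g F B' L.prod L'.prod := by
      refine fellowTravel_prod hm hmn hg (Nat.cast_nonneg β) hBpos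
        (fun b hb => by exact_mod_cast hH b hb) hβ hD ?_ (Set.mem_insert _ _) ?_ _ L L' rfl hL hL'
        (by omega) (by omega) ⟨e, e' * κ ^ N, h⟩
      · intro d hd
        exact ⟨Set.mem_insert_of_mem _ (Or.inl hd),
          Set.mem_insert_of_mem _ (Or.inr (Set.inv_mem_inv.2 hd))⟩
      · exact fun b hb => Set.mem_insert_of_mem _ (Or.inl hb)
    refine hft K f hf₁ _ _ (hpath.step (Set.mem_insert_of_mem _ (Or.inr (Or.inl he))) hc ?_
      ⟨1, 1, by rw [mul_one, mul_one, h]⟩) h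
    rw [h, inv_mul_cancel]
    exact Set.mem_insert _ _
  have key' : ∀ L L' : List (FreeMonoid A), (∀ b ∈ L, b ∈ 𝓑.blocks g κ E) →
      (∀ b ∈ L', b ∈ 𝓑.blocks g κ E) → ∀ e ∈ E, ∀ e' ∈ E, ∀ N N' : ℕ, N ≤ N' →
      FreeMonoid.lift g (L.prod * e * κ ^ N) = FreeMonoid.lift g (L'.prod * e' * κ ^ N') →
      FreeMonoid.lift f (L.prod * e * κ ^ N) = FreeMonoid.lift f (L'.prod * e' * κ ^ N') := by
    intro L L' hL hL' e he e' he' N N' hN h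
    obtain ⟨t, rfl⟩ := Nat.exists_eq_add_of_le' hN
    have hsplit : L'.prod * e' * κ ^ (t + N) = L'.prod * (e' * κ ^ t) * κ ^ N := by
      rw [pow_add]
      simp only [mul_assoc]
    rw [hsplit, map_mul, map_mul _ _ (κ ^ N)] at h ⊢
    rw [key L L' hL hL' e he e' he' t (mul_right_cancel h)]
  obtain ⟨L, hL, e, he, N, hu⟩ := hrew u
  obtain ⟨L', hL', e', he', N', hv⟩ := hrew v
  rw [hu G g hgρ₂, hv G g hgρ₂] at huv
  rw [hu K f hf₂, hv K f hf₂]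
  rcases le_total N N' with hN | hN
  · exact key' L L' hL hL' e he e' he' N N' hN huv
  · exact (key' L' L hL' hL e' he' e he N' N hN huv.symm).symm

end BSModel

/-! ### Construction of a model -/

/-- The point set of the permutation representation that separates normal forms. -/
abbrev NormalFormSpace (m : ℕ) : Type := List (Fin m) ⊕ ℕ

/-- The prescribed partial map is injective, and the summand `ℕ` makes both complements countably
infinite, so it extends to a bijection. -/
theorem exists_digit_equiv (m n : ℕ) (hm : 0 < m) (hn : 0 < n) :
    ∃ β : (Fin m × NormalFormSpace m) ≃ (Fin n × NormalFormSpace m),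
      ∀ (i : Fin m) (l : List (Fin m)), β (i, Sum.inl l) = (⟨0, hn⟩, Sum.inl (i :: l)) := by
  let s : Set (Fin m × NormalFormSpace m) := {p | ∃ l, p.2 = Sum.inl l}
  let f : s → Fin n × NormalFormSpace m := fun p => (⟨0, hn⟩, p.1.2.map (fun l => p.1.1 :: l) id)
  have hinj : Function.Injective f := by
    rintro ⟨⟨i, w⟩, hw⟩ ⟨⟨i', w'⟩, hw'⟩ h
    obtain ⟨l, hl : w = _⟩ := hw
    obtain ⟨l', hl' : w' = _⟩ := hw'
    subst hl hl'
    simpa [f] using h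
  have h₁ : Infinite (sᶜ : Set (Fin m × NormalFormSpace m)) :=
    Infinite.of_injective (β := ℕ)
      (fun k => ⟨(⟨0, hm⟩, Sum.inr k), by rintro ⟨l, hl⟩; cases hl⟩) (by
        intro a b h
        simpa using h)
  have h₂ : Infinite ((Set.range f)ᶜ : Set (Fin n × NormalFormSpace m)) :=
    Infinite.of_injective (β := ℕ)
      (fun k => ⟨(⟨0, hn⟩, Sum.inr k), by
        rintro ⟨⟨⟨i, w⟩, hw⟩, h⟩
        obtain ⟨l, hl : w = _⟩ := hw
        subst hl
        simp [f] at h⟩) (by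
        intro a b h
        simpa using h)
  obtain ⟨β, hβ⟩ := Cardinal.extend_function (⟨f, hinj⟩ : s ↪ Fin n × NormalFormSpace m)
    nonempty_equiv_of_countable
  exact ⟨β, fun i l => hβ ⟨(i, Sum.inl l), l, rfl⟩⟩

/-- Dividing the integer coordinate by `m`, applying the digit bijection to the remainder and
reassembling with `n` turns a shift by `m` into a shift by `n`. This is the Baumslag–Solitar
relation for permutations. -/
theorem exists_perm (m n : ℕ) (hm : 0 < m) (hn : 0 < n) :
    ∃ Y : Equiv.Perm (ℤ × NormalFormSpace m),
      (∀ a w, Y (a + m, w) = ((Y (a, w)).1 + n, (Y (a, w)).2)) ∧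
      ∀ (i : Fin m) (l : List (Fin m)), Y ((i : ℕ), Sum.inl l) = (0, Sum.inl (i :: l)) := by
  obtain ⟨β, hβ⟩ := exists_digit_equiv m n hm hn
  have : NeZero m := ⟨hm.ne'⟩
  have : NeZero n := ⟨hn.ne'⟩
  let Y : Equiv.Perm (ℤ × NormalFormSpace m) :=
    ((Int.divModEquiv m).prodCongr (Equiv.refl _)).trans <| (Equiv.prodAssoc _ _ _).trans <|
      ((Equiv.refl ℤ).prodCongr β).trans <| (Equiv.prodAssoc _ _ _).symm.trans <|
        (Int.divModEquiv n).symm.prodCongr (Equiv.refl _)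
  have hY : ∀ a w, Y (a, w) = (a / m * n + (β (Fin.ofNat m (a.natMod m), w)).1,
      (β (Fin.ofNat m (a.natMod m), w)).2) := fun a w => rfl
  refine ⟨Y, fun a w => ?_, fun i l => ?_⟩
  · have h1 : (a + m) / (m : ℤ) = a / m + 1 :=
      Int.add_ediv_of_dvd_right (dvd_refl _) |>.trans
        (by rw [Int.ediv_self (by exact_mod_cast hm.ne')])
    have h2 : (a + m).natMod m = a.natMod m := by simp [Int.natMod]
    rw [hY, hY, h1, h2]
    ext
    · simp only
      ring
    · rfl
  · have h1 : ((i : ℕ) : ℤ) / m = 0 := Int.ediv_eq_zero_of_lt (by positivity) (by exact_mod_cast i.2)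
    have h2 : ((i : ℕ) : ℤ).natMod m = i := by
      simp only [Int.natMod]
      rw [Int.emod_eq_of_lt (by positivity) (by exact_mod_cast i.2), Int.toNat_natCast]
    have h3 : Fin.ofNat m i = i := Fin.ext (Nat.mod_eq_of_lt i.2)
    rw [hY, h1, h2, h3, hβ]
    simp

/-- The action of the infinite cyclic group on the rationals by powers of `u`. -/
def scaling (u : ℚˣ) : Multiplicative ℤ →* MulAut (Multiplicative ℚ) :=
  (MulAutMultiplicative ℚ).symm.toMonoidHom.comp (AddAut.mulLeft.comp (zpowersHom ℚˣ u))

theorem toAdd_scaling (u : ℚˣ) (z : Multiplicative ℤ) (q : Multiplicative ℚ) :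
    (scaling u z q).toAdd = (u : ℚ) ^ z.toAdd * q.toAdd := by
  rw [← Units.val_zpow_eq_zpow_val]
  rfl

/-- The group is a product: the permutation factor separates normal forms, and the affine factor ℚ ⋊
ℤ carries height and translation. -/
theorem exists_BSModel (m n : ℕ) (hm : 0 < m) (hn : 0 < n) :
    ∃ (G : Type) (_ : Group G), Nonempty (BSModel m n G) := by
  obtain ⟨Y, hY, hY'⟩ := exists_perm m n hm hn
  have hm' : (m : ℚ) ≠ 0 := by exact_mod_cast hm.ne'
  have hn' : (n : ℚ) ≠ 0 := by exact_mod_cast hn.ne'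
  let u : ℚˣ := Units.mk0 ((n : ℚ) / m) (div_ne_zero hn' hm')
  let X : Equiv.Perm (ℤ × NormalFormSpace m) := (Equiv.addRight 1).prodCongr (Equiv.refl _)
  have hX : ∀ (k : ℕ) a w, (X ^ k) (a, w) = (a + k, w) := by
    intro k
    induction k with
    | zero => simp
    | succ k ih =>
      intro a w
      rw [pow_succ, Equiv.Perm.mul_apply]
      change (X ^ k) (a + 1, w) = _
      rw [ih]
      push_cast
      ring_nf
  let x : Multiplicative ℚ ⋊[scaling u] Multiplicative ℤ := ⟨Multiplicative.ofAdd 1, 1⟩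
  let y : Multiplicative ℚ ⋊[scaling u] Multiplicative ℤ := ⟨1, Multiplicative.ofAdd 1⟩
  have hx : ∀ k : ℕ, x ^ k = ⟨Multiplicative.ofAdd (k : ℚ), 1⟩ := by
    intro k
    induction k with
    | zero => rfl
    | succ k ih =>
      rw [pow_succ, ih]
      ext
      · simp [x, SemidirectProduct.mul_left]
      · simp [x]
  have hlin : ∀ (a b : Multiplicative ℚ ⋊[scaling u] Multiplicative ℤ),
      (a * b).left.toAdd = a.left.toAdd + ((n : ℚ) / m) ^ a.right.toAdd * b.left.toAdd := by
    intro a b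
    rw [SemidirectProduct.mul_left, toAdd_mul, toAdd_scaling]
    rfl
  refine ⟨Equiv.Perm (ℤ × NormalFormSpace m) × (Multiplicative ℚ ⋊[scaling u] Multiplicative ℤ),
    inferInstance, ⟨{
      x := (X, x)
      y := (Y, y)
      rel := ?_
      ht := fun g => g.2.right.toAdd
      ht_mul := fun a b => rfl
      ht_x := rfl
      ht_y := rfl
      tr := fun g => g.2.left.toAdd
      tr_mul := fun a b => hlin a.2 b.2
      tr_x := rfl
      tr_y := rfl
      normalForm_inj := ?_ }⟩⟩
  · refine Prod.ext (Equiv.ext ?_) (SemidirectProduct.ext ?_ ?_)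
    · rintro ⟨a, w⟩
      simp only [Prod.fst_mul, Prod.pow_fst, Equiv.Perm.mul_apply, hX, hY]
    · refine Multiplicative.toAdd.injective ?_
      simp only [Prod.snd_mul, Prod.pow_snd, hlin, hx]
      simp [y, hm']
    · simp [hx, y]
  · intro a b l l' h
    -- A normal form can be read off from the image of the base point, so distinct normal forms are
    -- distinct permutations.
    have key : ∀ (a : ℕ) (l : List (Fin m)), (X ^ a * digitWord X Y l) (0, Sum.inl []) =
        ((a : ℤ), Sum.inl l) := by
      have hd : ∀ l : List (Fin m), digitWord X Y l (0, Sum.inl []) = (0, Sum.inl l) := by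
        intro l
        induction l with
        | nil => rfl
        | cons i l ih =>
          rw [digitWord_cons, Equiv.Perm.mul_apply, Equiv.Perm.mul_apply, ih, hX, zero_add, hY']
      intro a l
      rw [Equiv.Perm.mul_apply, hd, hX, zero_add]
    have h' := congrArg (MonoidHom.fst (Equiv.Perm (ℤ × NormalFormSpace m))
      (Multiplicative ℚ ⋊[scaling u] Multiplicative ℤ)) h
    simp only [map_mul, map_pow, map_digitWord] at h'
    have h₂ := DFunLike.congr_fun h' (0, Sum.inl [])
    have h₃ := (key a l).symm.trans (h₂.trans (key b l'))
    simpa using h₃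

/-! ### Embedding the semigroup in the model -/

/-- The relation alone brings every element of `N` to normal form, and the model already keeps
normal forms apart. -/
theorem BSModel.injective_of_closure_eq_top {m n : ℕ} {G N : Type} [Group G] [Monoid N]
    (𝓑 : BSModel m n G) (hm : 0 < m) {X Y : N} (h : Y * X ^ m = X ^ n * Y)
    (htop : Submonoid.closure {X, Y} = ⊤) (f : N →* G) (hX : f X = 𝓑.x) (hY : f Y = 𝓑.y) :
    Function.Injective f ∧ ∀ z, f z ∈ 𝓑.pos := by
  have hnf : ∀ z, ∃ (a : ℕ) (l : List (Fin m)), z = X ^ a * digitWord X Y l := fun z =>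
    exists_eq_pow_mul_digitWord hm h (by rw [htop]; trivial)
  have hf : ∀ (a : ℕ) (l : List (Fin m)),
      f (X ^ a * digitWord X Y l) = 𝓑.x ^ a * digitWord 𝓑.x 𝓑.y l := by
    intro a l
    rw [map_mul, map_pow, map_digitWord, hX, hY]
  constructor
  · intro z w hzw
    obtain ⟨a, l, rfl⟩ := hnf z
    obtain ⟨b, l', rfl⟩ := hnf w
    rw [hf, hf] at hzw
    obtain ⟨rfl, rfl⟩ := 𝓑.normalForm_inj _ _ _ _ hzw
    rfl
  · intro z
    obtain ⟨a, l, rfl⟩ := hnf z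
    rw [hf]
    exact mul_mem (pow_mem_closure_pair _ _ _) (digitWord_mem_closure_pair _ _ _)

namespace BaumslagSolitarSemigroup

variable {m n : ℕ}

/-- The class of a generator. -/
def gen (m n : ℕ) (s : BSGen) : BaumslagSolitarSemigroup m n :=
  Con.toQuotient (FreeSemigroup.of s)

theorem map_iterate_mul_right {M : Type} [Monoid M] (φ : FreeSemigroup BSGen →ₙ* M) (k : ℕ) :
    φ ((fun w => w * FreeSemigroup.of BSGen.x)^[k] (FreeSemigroup.of BSGen.y)) =
      φ (FreeSemigroup.of BSGen.y) * φ (FreeSemigroup.of BSGen.x) ^ k := by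
  induction k with
  | zero => simp
  | succ k ih => rw [Function.iterate_succ_apply', map_mul, ih, pow_succ, mul_assoc]

theorem map_iterate_mul_left {M : Type} [Monoid M] (φ : FreeSemigroup BSGen →ₙ* M) (k : ℕ) :
    φ ((fun w => FreeSemigroup.of BSGen.x * w)^[k] (FreeSemigroup.of BSGen.y)) =
      φ (FreeSemigroup.of BSGen.x) ^ k * φ (FreeSemigroup.of BSGen.y) := by
  induction k with
  | zero => simp
  | succ k ih => rw [Function.iterate_succ_apply', map_mul, ih, pow_succ', mul_assoc]

/-- The map from the free semigroup to the Baumslag--Solitar semigroup with an identity added. -/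
def mkHom (m n : ℕ) : FreeSemigroup BSGen →ₙ* WithOne (BaumslagSolitarSemigroup m n) where
  toFun w := ((Con.toQuotient w : BaumslagSolitarSemigroup m n) : WithOne _)
  map_mul' _ _ := rfl

theorem rel_withOne (m n : ℕ) :
    (gen m n .y : WithOne (BaumslagSolitarSemigroup m n)) * gen m n .x ^ m =
      gen m n .x ^ n * gen m n .y := by
  have h : mkHom m n ((fun w => w * FreeSemigroup.of BSGen.x)^[m] (FreeSemigroup.of BSGen.y)) =
      mkHom m n ((fun w => FreeSemigroup.of BSGen.x * w)^[n] (FreeSemigroup.of BSGen.y)) :=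
    congrArg (WithOne.coe : BaumslagSolitarSemigroup m n → WithOne (BaumslagSolitarSemigroup m n))
      ((Con.eq (conGen (BSRel m n))).2 (ConGen.Rel.of _ _ BSRel.rel))
  rw [map_iterate_mul_right, map_iterate_mul_left] at h
  exact h

theorem closure_gen_eq_top (m n : ℕ) :
    Submonoid.closure {(gen m n .x : WithOne (BaumslagSolitarSemigroup m n)), ↑(gen m n .y)} =
      ⊤ := by
  have hgen : ∀ s, ((gen m n s : BaumslagSolitarSemigroup m n) : WithOne _) ∈ Submonoid.closure
      {(gen m n .x : WithOne (BaumslagSolitarSemigroup m n)), ↑(gen m n .y)} := by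
    rintro (_ | _) <;> exact Submonoid.subset_closure (by simp)
  have hmk : ∀ w, mkHom m n w ∈ Submonoid.closure
      {(gen m n .x : WithOne (BaumslagSolitarSemigroup m n)), ↑(gen m n .y)} := by
    intro w
    induction w using FreeSemigroup.recOnMul with
    | ih1 s => exact hgen s
    | ih2 s w _ ih =>
      rw [map_mul]
      exact mul_mem (hgen s) ih
  refine top_le_iff.1 fun z _ => ?_
  induction z using WithOne.recOneCoe with
  | one => exact one_mem _
  | coe z => exact Con.induction_on z hmk

theorem exists_lift {M : Type} [Monoid M] {x y : M} (h : y * x ^ m = x ^ n * y) :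
    ∃ f : WithOne (BaumslagSolitarSemigroup m n) →* M, f (gen m n .x) = x ∧ f (gen m n .y) = y := by
  let φ : FreeSemigroup BSGen →ₙ* M := FreeSemigroup.lift fun s => match s with
    | .x => x
    | .y => y
  have hx : φ (FreeSemigroup.of .x) = x := FreeSemigroup.lift_of _ _
  have hy : φ (FreeSemigroup.of .y) = y := FreeSemigroup.lift_of _ _
  have hle : conGen (BSRel m n) ≤ Con.ker φ := by
    refine Con.conGen_le.2 ?_
    rintro _ _ ⟨⟩
    change φ _ = φ _
    rw [map_iterate_mul_right, map_iterate_mul_left, hx, hy, h]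
  let f : BaumslagSolitarSemigroup m n →ₙ* M :=
    { toFun := fun q => Con.liftOn q φ fun a b hab => hle hab
      map_mul' := fun p q => Con.induction_on₂ p q fun a b => φ.map_mul a b }
  exact ⟨WithOne.lift f, hx, hy⟩

end BaumslagSolitarSemigroup

open BaumslagSolitarSemigroup in
theorem mainTheorem5 (m n : ℕ) (hm : 0 < m) (hn : 0 < n) (hmn : m ≠ n) :
    IsMalcevCoherent (BaumslagSolitarSemigroup m n) := by
  let c : BaumslagSolitarSemigroup m n →ₙ* WithOne (BaumslagSolitarSemigroup m n) :=
    WithOne.coeMulHom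
  have hc : Function.Injective c := WithOne.coe_injective
  obtain ⟨G, _, ⟨𝓑⟩⟩ := exists_BSModel m n hm hn
  obtain ⟨f, hfx, hfy⟩ := exists_lift (m := m) (n := n) 𝓑.rel
  obtain ⟨hinj, hpos⟩ :=
    𝓑.injective_of_closure_eq_top hm (rel_withOne m n) (closure_gen_eq_top m n) f hfx hfy
  refine ⟨⟨G, inferInstance, (f : _ →ₙ* G).comp c, hinj.comp hc⟩, fun X hX => ?_⟩
  have := hX.to_subtype
  rcases hmn.lt_or_gt with hlt | hlt
  · exact hasFiniteMalcevPresentation_closure ((f : _ →ₙ* G).comp c) (hinj.comp hc) X hX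
      (𝓑.hasFiniteRelators hm hlt fun a => hpos _)
  -- Read from right to left, the relation becomes that of `S(n, m)`. The opposite monoid therefore
  -- embeds in a model with ratio `m/n > 1`, and its relators are reversed at the end.
  · obtain ⟨G', _, ⟨𝓑'⟩⟩ := exists_BSModel n m hn hm
    obtain ⟨j, hjx, hjy⟩ := exists_lift (m := m) (n := n) (M := G'ᵐᵒᵖ) (x := .op 𝓑'.x)
      (y := .op 𝓑'.y) (MulOpposite.unop_injective 𝓑'.rel.symm)
    let f' : (WithOne (BaumslagSolitarSemigroup m n))ᵐᵒᵖ →* G' :=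
      { toFun := fun z => (j z.unop).unop
        map_one' := by simp
        map_mul' := fun a b => by simp }
    have hrel : MulOpposite.op (gen m n .y : WithOne (BaumslagSolitarSemigroup m n)) *
        .op ↑(gen m n .x) ^ n = .op ↑(gen m n .x) ^ m * .op ↑(gen m n .y) :=
      MulOpposite.unop_injective (rel_withOne m n).symm
    obtain ⟨hinj', hpos'⟩ := 𝓑'.injective_of_closure_eq_top hn hrel
      (by
        have h := congrArg Submonoid.op (closure_gen_eq_top m n)
        rw [Submonoid.op_closure, Submonoid.op_top] at h
        rw [← h]
        congr 1
        ext z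
        simp [← MulOpposite.unop_inj])
      f' (by simp [f', hjx]) (by simp [f', hjy])
    have hj : Function.Injective j := fun a b hab =>
      MulOpposite.op_injective (hinj' (congrArg MulOpposite.unop hab))
    exact hasFiniteMalcevPresentation_closure ((j : _ →ₙ* G'ᵐᵒᵖ).comp c) (hj.comp hc) X hX
      (𝓑'.hasFiniteRelators (g := fun a : X => f' (.op (c a))) hn hlt fun a => hpos' _).op
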